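/- Let $(V,V^+,e)$ be an AOU space: $V$ is a complex $*$-vector space, $V^+\subseteq V_h=\{x\in V: x^*=x\}$ is a cone with $V^+\cap(-V^+)=\{0\}$, and $e\in V_h$ is an Archimedean order unit, i.e. for every $x\in V_h$ there is a real $r>0$ with $re-x\in V^+$, and $x\in V^+$ whenever $re+x\in V^+$ for all real $r>0$. For $x,y\in V_h$ write $x\le y$ if $y-x\in V^+$, and let $\|x\|=\inf\{t\ge 0: -te\le x\le te\}$ be the order norm of $x\in V_h$. For $v\in V$ let $$\|v\|_{\mathrm{dec}}=\inf\Big\{\Big\|\sum_{j=1}^k|\lambda_j|v_j\Big\| : v=\sum_{j=1}^k\lambda_jv_j,\ \lambda_j\in\mathbb C,\ v_j\in V^+\Big\}.$$ Let $\mathrm{OMAX}(V)=(V,\{C_n^{\max}(V)\}_{n\ge1},e)$ be the maximal operator system structure on $V$, where $$C_n^{\max}(V)=\{A\in M_n(V): re_n+A\in D_n^{\max}(V)\text{ for all } r>0\},\qquad e_n=\mathrm{diag}(e,\dots,e),$$ $$D_n^{\max}(V)=\Big\{\sum_{i=1}^k a_i\otimes v_i : k\in\mathbb N,\ a_i\in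 M_n(\mathbb C)^+,\ v_i\in V^+\Big\},$$ and let $\|\cdot\|_{\mathrm{OMAX}(V)}$ be its operator system norm, $$\|v\|_{\mathrm{OMAX}(V)}=\inf\Big\{t\ge0:\begin{pmatrix}te&v\\v^*&te\end{pmatrix}\in C_2^{\max}(V)\Big\}.$$ Then for every $v\in V$, $$\|v\|_{\mathrm{dec}}=\|v\|_{\mathrm{OMAX}(V)}=\sup\{\|\phi(v)\| : \phi:V\to B(H)\},$$ where the supremum is taken over all complex Hilbert spaces $H$ and all unital positive linear maps $\phi:V\to B(H)$, that is, linear maps with $\phi(e)=I$ and $\phi(x)\ge0$ for all $x\in V^+$. -/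

import Mathlib

universe u w

namespace OMax

section

variable {V : Type u} [AddCommGroup V] [Module ℂ V] [StarAddMonoid V]

/-- `(V, P, e)` is an Archimedean order unit (AOU) space: `P` is a proper cone of hermitian
elements of the `*`-vector space `V`, and `e` is an Archimedean order unit. -/
structure IsAOUSpace (P : Set V) (e : V) : Prop where
  nonempty : P.Nonempty
  hermitian : ∀ x ∈ P, star x = x
  smul_mem : ∀ r : ℝ, 0 ≤ r → ∀ x ∈ P, (r : ℂ) • x ∈ P
  add_mem : ∀ x ∈ P, ∀ y ∈ P, x + y ∈ P
  proper : ∀ x, x ∈ P → -x ∈ P → x = 0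
  unit_hermitian : star e = e
  order_unit : ∀ x, star x = x → ∃ r : ℝ, 0 < r ∧ (r : ℂ) • e - x ∈ P
  archimedean : ∀ x, (∀ r : ℝ, 0 < r → (r : ℂ) • e + x ∈ P) → x ∈ P

/-- The order norm of a hermitian element, `inf {t : -t e ≤ x ≤ t e}`. The restriction `0 ≤ t`
is automatic unless `V = 0`, where it makes the infimum `0`. -/
noncomputable def orderNorm (P : Set V) (e x : V) : ℝ :=
  sInf {t : ℝ | 0 ≤ t ∧ x + (t : ℂ) • e ∈ P ∧ (t : ℂ) • e - x ∈ P}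

/-- The decomposition norm: the infimum of the order norms of `∑ |λ_j| v_j` over all
decompositions `v = ∑ λ_j v_j` with `λ_j ∈ ℂ` and `v_j ∈ P`. -/
noncomputable def decNorm (P : Set V) (e v : V) : ℝ :=
  sInf {t : ℝ | ∃ (k : ℕ) (l : Fin k → ℂ) (x : Fin k → V), (∀ j, x j ∈ P) ∧
    v = ∑ j, l j • x j ∧ t = orderNorm P e (∑ j, ((‖l j‖ : ℝ) : ℂ) • x j)}

open scoped ComplexOrder in
/-- The cone `D_n^max` of all finite sums `∑ a_i ⊗ x_i` with `a_i ∈ M_n(ℂ)` positive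
semidefinite and `x_i ∈ P`, where `a ⊗ x ∈ M_n(V)` has entries `a_{ij} x`. -/
def dMax (P : Set V) (n : ℕ) : Set (Matrix (Fin n) (Fin n) V) :=
  {A | ∃ (k : ℕ) (a : Fin k → Matrix (Fin n) (Fin n) ℂ) (x : Fin k → V),
    (∀ i, (a i).PosSemidef) ∧ (∀ i, x i ∈ P) ∧ A = ∑ i, (a i).map (fun z => z • x i)}

/-- The matrix cones `C_n^max` of `OMAX(V)`: all `A` with `r e_n + A ∈ D_n^max` for every
`r > 0`, where `e_n = diag(e, …, e)`. -/
def cMax (P : Set V) (e : V) (n : ℕ) : Set (Matrix (Fin n) (Fin n) V) :=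
  {A | ∀ r : ℝ, 0 < r → (r : ℂ) • Matrix.diagonal (fun _ => e) + A ∈ dMax P n}

/-- The norm of an element of an operator system `(V, {C_n}, e)`: the infimum of the `t ≥ 0`
such that the `2 × 2` matrix with rows `(t e, v)` and `(v^*, t e)` lies in `C_2`. -/
noncomputable def operatorSystemNorm (C : ∀ n : ℕ, Set (Matrix (Fin n) (Fin n) V))
    (e v : V) : ℝ :=
  sInf {t : ℝ | 0 ≤ t ∧ !![(t : ℂ) • e, v; star v, (t : ℂ) • e] ∈ C 2}

/-- The norm of the operator system `OMAX(V) = (V, {C_n^max}, e)`. -/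
noncomputable def omaxNorm (P : Set V) (e v : V) : ℝ :=
  operatorSystemNorm (cMax P e) e v

/-- Unital positive linear maps from `(V, P, e)` to `B(H)`. -/
structure IsUnitalPositive (P : Set V) (e : V) {H : Type w} [NormedAddCommGroup H]
    [InnerProductSpace ℂ H] (φ : V →ₗ[ℂ] (H →L[ℂ] H)) : Prop where
  unital : φ e = 1
  positive : ∀ x ∈ P, (φ x).IsPositive

end

end OMax

/-!
Both norms of `v` are the infimum of the `t ≥ 0` for which `(t e, v)` lies in the cone of pairs
`(h, v)` such that `v = ∑ λ_j x_j` with `x_j` positive and `∑ |λ_j| x_j ≤ h`: the off-diagonal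
entry of a positive semidefinite `2 × 2` matrix is at most the mean of its diagonal entries, and
`[[|λ|, λ], [conj λ, |λ|]]` is positive semidefinite.

If `(t e, v)` lies in this cone and `φ` is unital and positive, then Cauchy–Schwarz for the forms
`⟪φ (x_j) ξ, η⟫` gives `‖φ v‖ ≤ ‖∑ |λ_j| φ (x_j)‖ ≤ t`. If it does not, Hahn–Banach separation
gives functionals `s` and `f` with `s e = 1`, `|f| ≤ s` on the positive cone and `t ≤ |f v|`. Then
`x ↦ [[s x, f x], [conj (f x^*), s x]]` is positive; after `f` is shrunk slightly its value at `e`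
is invertible, and conjugating by the inverse square root of that value gives a unital positive
`φ` with `|f v| ≤ ‖φ v‖`.
-/

namespace OMax

open scoped ComplexOrder InnerProductSpace ComplexStarModule
open InnerProductSpace (rankOne)

section Separation

variable {E : Type*} [AddCommGroup E] [Module ℝ E] {C : PointedCone ℝ E} {u y : E}

theorem exists_normalized_nonneg_functional (hunit : ∀ z, ∃ a : ℝ, a • u + z ∈ C)
    (hu : -u ∉ C) : ∃ g : E →ₗ[ℝ] ℝ, (∀ z ∈ C, 0 ≤ g z) ∧ g u = 1 := by
  have hu0 : u ≠ 0 := by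
    rintro rfl
    exact hu (by simp)
  have coeff_nonneg : ∀ a : ℝ, a • u ∈ C → 0 ≤ a := by
    intro a ha
    by_contra! hneg
    refine hu ?_
    have := C.smul_mem (inv_nonneg.2 (neg_nonneg.2 hneg.le)) ha
    rwa [smul_smul, inv_neg, neg_mul, inv_mul_cancel₀ hneg.ne, neg_one_smul] at this
  obtain ⟨g, hg, hgC⟩ := riesz_extension C (LinearPMap.mkSpanSingleton u (1 : ℝ) hu0)
    (by
      rintro ⟨x, hx⟩ h
      obtain ⟨a, rfl⟩ := Submodule.mem_span_singleton.1 hx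
      rw [LinearPMap.mkSpanSingleton'_apply]
      simpa using coeff_nonneg a h)
    (fun z => (hunit z).imp' (fun a => ⟨a • u, Submodule.mem_span_singleton.2 ⟨a, rfl⟩⟩)
      fun _ ha => ha)
  refine ⟨g, hgC, ?_⟩
  have := hg ⟨u, Submodule.mem_span_singleton_self u⟩
  rwa [LinearPMap.mkSpanSingleton_apply] at this

theorem exists_normalized_nonneg_functional_of_notMem
    (hunit : ∀ z, ∃ a : ℝ, 0 ≤ a ∧ a • u + z ∈ C) (hy : y ∉ C) :
    ∃ g : E →ₗ[ℝ] ℝ, (∀ z ∈ C, 0 ≤ g z) ∧ g u = 1 ∧ g y ≤ 0 := by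
  have neg_unit_notMem : -u ∉ C ⊔ PointedCone.hull ℝ {-y} := by
    intro h
    obtain ⟨k, hk, m, hm, hkm⟩ := Submodule.mem_sup.1 h
    obtain ⟨⟨c, hc⟩, rfl⟩ := Submodule.mem_span_singleton.1 hm
    obtain ⟨a, ha, hay⟩ := hunit y
    -- `(1 + a c) y = (a u + y) + a k`, and the left coefficient is positive.
    have hky : (1 + a * c) • y ∈ C := by
      have hkm' : k + c • -y = -u := hkm
      have : (1 + a * c) • y = (a • u + y) + a • k := by
        rw [eq_sub_of_add_eq hkm']
        module
      exact this ▸ C.add_mem hay (C.smul_mem ha hk)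
    have hpos : 0 < 1 + a * c := by positivity
    refine hy ?_
    simpa [smul_smul, inv_mul_cancel₀ hpos.ne'] using C.smul_mem (inv_nonneg.2 hpos.le) hky
  obtain ⟨g, hg, hgu⟩ := exists_normalized_nonneg_functional
    (fun z => (hunit z).imp fun _ ha => Submodule.mem_sup_left ha.2) neg_unit_notMem
  refine ⟨g, fun z hz => hg z (Submodule.mem_sup_left hz), hgu, ?_⟩
  have := hg (-y) (Submodule.mem_sup_right (PointedCone.subset_hull rfl))
  simpa using this

end Separation

section Matrix

theorem posSemidef_norm_self (z : ℂ) :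
    (!![(‖z‖ : ℂ), z; star z, (‖z‖ : ℂ)]).PosSemidef := by
  obtain ⟨c, hc, hcz⟩ := Complex.exists_norm_mul_eq_self z
  have hfactor : !![(‖z‖ : ℂ), z; star z, (‖z‖ : ℂ)] =
      (‖z‖ : ℂ) • Matrix.vecMulVec ![c, 1] (star ![c, 1]) := by
    have hzs : star z = ‖z‖ * star c := by
      conv_lhs => rw [← hcz]
      simp [mul_comm]
    ext i j
    simp only [Matrix.smul_apply, Matrix.vecMulVec_apply, Pi.star_apply]
    fin_cases i <;> fin_cases j
    · simp [Complex.mul_conj', hc]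
    · simpa [mul_comm] using hcz.symm
    · simpa using hzs
    · simp
  rw [hfactor]
  exact (Matrix.posSemidef_vecMulVec_self_star _).smul (by simp)

theorem norm_apply_zero_one_le_of_posSemidef {a : Matrix (Fin 2) (Fin 2) ℂ}
    (ha : a.PosSemidef) : ‖a 0 1‖ ≤ ((a 0 0).re + (a 1 1).re) / 2 := by
  obtain ⟨h0, h0'⟩ := Complex.nonneg_iff.1 (ha.diag_nonneg (i := 0))
  obtain ⟨h1, -⟩ := Complex.nonneg_iff.1 (ha.diag_nonneg (i := 1))
  have h10 : a 1 0 = star (a 0 1) := (ha.isHermitian.apply 1 0).symm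
  have hdet : ‖a 0 1‖ ^ 2 ≤ (a 0 0).re * (a 1 1).re := by
    have := (Complex.nonneg_iff.1 ha.det_nonneg).1
    rw [Matrix.det_fin_two, h10, Complex.star_def, Complex.mul_conj', Complex.sub_re,
      Complex.mul_re, ← h0', zero_mul, sub_zero] at this
    norm_cast at this
    linarith
  nlinarith [norm_nonneg (a 0 1), sq_nonneg ((a 0 0).re - (a 1 1).re)]

end Matrix

section Operators

variable {H : Type*} [NormedAddCommGroup H] [InnerProductSpace ℂ H]

theorem isPositive_smul_one_add_rankOne {ξ η : H} (hξη : Orthonormal ℂ ![ξ, η]) {a b : ℂ}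
    (hba : (‖b‖ : ℂ) ≤ a) :
    (a • (1 : H →L[ℂ] H) + (b • rankOne ℂ ξ η + star b • rankOne ℂ η ξ)).IsPositive := by
  rw [ContinuousLinearMap.isPositive_iff_complex]
  intro ζ
  lift a to ℝ using (Complex.le_def.1 hba).2.symm
  have hba' : ‖b‖ ≤ a := by exact_mod_cast hba
  have hbessel : ‖⟪ξ, ζ⟫_ℂ‖ ^ 2 + ‖⟪η, ζ⟫_ℂ‖ ^ 2 ≤ ‖ζ‖ ^ 2 := by
    simpa using hξη.sum_inner_products_le (x := ζ) (s := Finset.univ)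
  set T := (a : ℂ) • (1 : H →L[ℂ] H) + (b • rankOne ℂ ξ η + star b • rankOne ℂ η ξ)
  set w := b * (star ⟪ξ, ζ⟫_ℂ * ⟪η, ζ⟫_ℂ)
  have hquad : ⟪T ζ, ζ⟫_ℂ = ((a * ‖ζ‖ ^ 2 + 2 * w.re : ℝ) : ℂ) := by
    have hw : ((2 * w.re : ℝ) : ℂ) = w + star w := (Complex.add_conj w).symm
    rw [Complex.ofReal_add, hw]
    simp [T, w, inner_self_eq_norm_sq_to_K]
    ring
  have hw_le : -(‖b‖ * (‖⟪ξ, ζ⟫_ℂ‖ * ‖⟪η, ζ⟫_ℂ‖)) ≤ w.re := by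
    rw [← norm_star ⟪ξ, ζ⟫_ℂ, ← norm_mul, ← norm_mul]
    exact (abs_le.1 (Complex.abs_re_le_norm w)).1
  rw [hquad, RCLike.re_to_complex, Complex.ofReal_re]
  refine ⟨rfl, ?_⟩
  nlinarith [sq_nonneg (‖⟪ξ, ζ⟫_ℂ‖ - ‖⟪η, ζ⟫_ℂ‖), norm_nonneg b]

variable [CompleteSpace H]

theorem norm_inner_le_of_isPositive {T : H →L[ℂ] H} (hT : T.IsPositive) (ξ η : H) :
    ‖⟪T ξ, η⟫_ℂ‖ ≤ (T.reApplyInnerSelf ξ + T.reApplyInnerSelf η) / 2 := by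
  obtain ⟨S, rfl⟩ := CStarAlgebra.nonneg_iff_eq_star_mul_self.1
    ((ContinuousLinearMap.nonneg_iff_isPositive T).2 hT)
  have hS : ∀ ζ ω : H, ⟪(star S * S) ζ, ω⟫_ℂ = ⟪S ζ, S ω⟫_ℂ := fun ζ ω => by
    rw [ContinuousLinearMap.star_eq_adjoint, mul_apply_eq_comp,
      ContinuousLinearMap.adjoint_inner_left]
  simp only [ContinuousLinearMap.reApplyInnerSelf_apply, hS, inner_self_eq_norm_sq]
  nlinarith [norm_inner_le_norm (𝕜 := ℂ) (S ξ) (S η), sq_nonneg (‖S ξ‖ - ‖S η‖)]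

theorem norm_sum_smul_le_norm_sum_norm_smul {ι : Type*} (s : Finset ι) (l : ι → ℂ)
    {T : ι → H →L[ℂ] H} (hT : ∀ i ∈ s, (T i).IsPositive) :
    ‖∑ i ∈ s, l i • T i‖ ≤ ‖∑ i ∈ s, ‖l i‖ • T i‖ := by
  set S := ∑ i ∈ s, ‖l i‖ • T i with hS
  have hself : ∀ ζ : H, S.reApplyInnerSelf ζ = ∑ i ∈ s, ‖l i‖ * (T i).reApplyInnerSelf ζ :=
    fun ζ => by
      simp [hS, ContinuousLinearMap.reApplyInnerSelf_apply, sum_inner]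
  have hself_le : ∀ ζ : H, ‖ζ‖ = 1 → S.reApplyInnerSelf ζ ≤ ‖S‖ := fun ζ hζ => by
    refine (RCLike.re_le_norm _).trans ((norm_inner_le_norm _ _).trans ?_)
    simpa [hζ] using S.le_opNorm ζ
  refine ContinuousLinearMap.opNorm_le_of_re_inner_le (𝕜 := ℂ) (norm_nonneg _) fun ξ η hξ hη => ?_
  calc RCLike.re ⟪(∑ i ∈ s, l i • T i) ξ, η⟫_ℂ
      ≤ ‖⟪(∑ i ∈ s, l i • T i) ξ, η⟫_ℂ‖ := RCLike.re_le_norm _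
    _ ≤ ∑ i ∈ s, ‖l i‖ * ‖⟪T i ξ, η⟫_ℂ‖ := by
      simp only [_root_.sum_apply, sum_inner, _root_.smul_apply, inner_smul_left]
      exact (norm_sum_le _ _).trans_eq (by simp)
    _ ≤ ∑ i ∈ s, ‖l i‖ * (((T i).reApplyInnerSelf ξ + (T i).reApplyInnerSelf η) / 2) := by
      gcongr with i hi
      exact norm_inner_le_of_isPositive (hT i hi) ξ η
    _ = (S.reApplyInnerSelf ξ + S.reApplyInnerSelf η) / 2 := by
      rw [hself, hself, ← Finset.sum_add_distrib, Finset.sum_div]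
      exact Finset.sum_congr rfl fun i _ => by ring
    _ ≤ ‖S‖ := by linarith [hself_le ξ hξ, hself_le η hη]

end Operators

section Cone

variable {V : Type u} [AddCommGroup V] [Module ℂ V] {K : PointedCone ℝ V} {h h' v x : V}

/-- The cone of pairs `(h, v)` for which `v` has a decomposition `v = ∑ λ_j x_j` with `x_j ∈ K`
and `∑ |λ_j| x_j ≤ h`. The decomposition norm of `v` is the infimum of the `t ≥ 0` such that
`(t e, v)` lies in this cone. -/
def decMajorantCone (K : PointedCone ℝ V) : PointedCone ℝ (V × V) where
  carrier := {p | ∃ (k : ℕ) (l : Fin k → ℂ) (x : Fin k → V), (∀ j, x j ∈ K) ∧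
    p.2 = ∑ j, l j • x j ∧ p.1 - ∑ j, ‖l j‖ • x j ∈ K}
  zero_mem' := ⟨0, Fin.elim0, Fin.elim0, fun j => j.elim0, by simp, by simp⟩
  add_mem' := by
    rintro ⟨h, v⟩ ⟨h', v'⟩ ⟨k, l, x, hx, hv, hh⟩ ⟨k', l', x', hx', hv', hh'⟩
    refine ⟨k + k', Fin.append l l', Fin.append x x', fun j => ?_, ?_, ?_⟩
    · induction j using Fin.addCases with
      | left j => simpa using hx j
      | right j => simpa using hx' j
    · simpa [Fin.sum_univ_add] using congrArg₂ (· + ·) hv hv'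
    · simpa [Fin.sum_univ_add, add_sub_add_comm] using K.add_mem hh hh'
  smul_mem' := by
    rintro ⟨r, hr⟩ ⟨h, v⟩ ⟨k, l, x, hx, hv, hh⟩
    refine ⟨k, l, fun j => r • x j, fun j => K.smul_mem hr (hx j), ?_, ?_⟩
    · calc r • v = ∑ j, r • l j • x j := by rw [show v = _ from hv, Finset.smul_sum]
        _ = ∑ j, l j • r • x j := by simp only [smul_comm r]
    · have : r • (h - ∑ j, ‖l j‖ • x j) = r • h - ∑ j, ‖l j‖ • r • x j := by
        simp only [smul_sub, Finset.smul_sum, smul_comm r]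
      exact this ▸ K.smul_mem hr hh

theorem mem_decMajorantCone : (h, v) ∈ decMajorantCone K ↔
    ∃ (k : ℕ) (l : Fin k → ℂ) (x : Fin k → V), (∀ j, x j ∈ K) ∧
      v = ∑ j, l j • x j ∧ h - ∑ j, ‖l j‖ • x j ∈ K :=
  Iff.rfl

theorem norm_smul_smul_mem_decMajorantCone (hx : x ∈ K) (c : ℂ) :
    (‖c‖ • x, c • x) ∈ decMajorantCone K :=
  mem_decMajorantCone.2 ⟨1, fun _ => c, fun _ => x, fun _ => hx, by simp, by simp⟩

theorem mem_decMajorantCone_of_sub_mem (hv : (h, v) ∈ decMajorantCone K) (hh : h' - h ∈ K) :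
    (h', v) ∈ decMajorantCone K := by
  obtain ⟨k, l, x, hx, hv, hsub⟩ := mem_decMajorantCone.1 hv
  refine mem_decMajorantCone.2 ⟨k, l, x, hx, hv, ?_⟩
  simpa using K.add_mem hh hsub

theorem mem_of_mem_decMajorantCone (hv : (h, v) ∈ decMajorantCone K) : h ∈ K := by
  obtain ⟨k, l, x, hx, -, hsub⟩ := mem_decMajorantCone.1 hv
  have hsum : ∑ j, ‖l j‖ • x j ∈ K := K.sum_mem fun j _ => K.smul_mem (norm_nonneg _) (hx j)
  simpa using K.add_mem hsub hsum

theorem mem_decMajorantCone_of_mem_dMax {w : V} (hA : !![h, v; w, h] ∈ dMax (K : Set V) 2) :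
    (h, v) ∈ decMajorantCone K := by
  obtain ⟨k, a, x, ha, hx, hA⟩ := hA
  have entry : ∀ p q : Fin 2, !![h, v; w, h] p q = ∑ i, a i p q • x i := fun p q => by
    rw [hA]
    simp [Matrix.sum_apply]
  have diag_re : ∀ i (p : Fin 2), a i p p • x i = (a i p p).re • x i := fun i p => by
    rw [← Complex.coe_smul, Complex.conj_eq_iff_re.1 ((ha i).isHermitian.apply p p)]
  refine mem_decMajorantCone.2 ⟨k, fun i => a i 0 1, x, hx, entry 0 1, ?_⟩
  have hdiag : h = ∑ i, (((a i 0 0).re + (a i 1 1).re) / 2) • x i := by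
    have h0 : h = ∑ i, (a i 0 0).re • x i := (entry 0 0).trans (by simp only [diag_re])
    have h1 : h = ∑ i, (a i 1 1).re • x i := (entry 1 1).trans (by simp only [diag_re])
    have : h = (2⁻¹ : ℝ) • (h + h) := by module
    rw [this]
    nth_rewrite 1 [h0]
    rw [h1, ← Finset.sum_add_distrib, Finset.smul_sum]
    exact Finset.sum_congr rfl fun i _ => by module
  rw [hdiag, ← Finset.sum_sub_distrib]
  refine K.sum_mem fun i _ => ?_
  rw [← sub_smul]
  exact K.smul_mem (sub_nonneg.2 (norm_apply_zero_one_le_of_posSemidef (ha i))) (hx i)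

variable [StarAddMonoid V] [StarModule ℂ V]

theorem mem_dMax_two_iff_mem_decMajorantCone (hK : ∀ x ∈ K, IsSelfAdjoint x) :
    !![h, v; star v, h] ∈ dMax (K : Set V) 2 ↔ (h, v) ∈ decMajorantCone K := by
  refine ⟨mem_decMajorantCone_of_mem_dMax, fun hv => ?_⟩
  obtain ⟨k, l, x, hx, rfl, hsub⟩ := mem_decMajorantCone.1 hv
  refine ⟨k + 1, Fin.cons 1 fun j => !![(‖l j‖ : ℂ), l j; star (l j), (‖l j‖ : ℂ)],
    Fin.cons (h - ∑ j, ‖l j‖ • x j) x, Fin.cases Matrix.PosSemidef.one fun j =>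
      posSemidef_norm_self (l j), Fin.cases hsub hx, ?_⟩
  have hstar : star (∑ j, l j • x j) = ∑ j, star (l j) • x j := by
    simp [star_sum, fun j => (hK _ (hx j)).star_eq]
  rw [Fin.sum_univ_succ]
  ext p q
  fin_cases p <;> fin_cases q <;> simp [Matrix.sum_apply, hstar]

/-- `(V, K, e)` is an order unit space: an AOU space without the requirements that `K` be proper
and that `e` be Archimedean. -/
structure IsOrderUnitCone (K : PointedCone ℝ V) (e : V) : Prop where
  isSelfAdjoint : ∀ x ∈ K, IsSelfAdjoint x
  exists_smul_sub_mem : ∀ x, IsSelfAdjoint x → ∃ r : ℝ, 0 < r ∧ r • e - x ∈ K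

end Cone

section OrderUnit

variable {V : Type u} [AddCommGroup V] [Module ℂ V] {K : PointedCone ℝ V} {e h v : V} {t : ℝ}

theorem orderNorm_nonneg (P : Set V) (e h : V) : 0 ≤ orderNorm P e h :=
  Real.sInf_nonneg fun _ ht => ht.1

theorem orderNorm_le_of_mem (he : e ∈ K) (hh : h ∈ K) (ht : 0 ≤ t) (hle : t • e - h ∈ K) :
    orderNorm (K : Set V) e h ≤ t := by
  unfold orderNorm
  exact csInf_le ⟨0, fun _ hs => hs.1⟩ ⟨ht, add_mem hh (K.smul_mem ht he), hle⟩

theorem decNorm_nonneg (P : Set V) (e v : V) : 0 ≤ decNorm P e v :=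
  Real.sInf_nonneg <| by
    rintro _ ⟨k, l, x, -, -, rfl⟩
    exact orderNorm_nonneg P e _

theorem decNorm_sum_smul_le_orderNorm {P : Set V} (e : V) {k : ℕ} (l : Fin k → ℂ) {x : Fin k → V}
    (hx : ∀ j, x j ∈ P) : decNorm P e (∑ j, l j • x j) ≤ orderNorm P e (∑ j, ‖l j‖ • x j) := by
  unfold decNorm
  refine csInf_le ⟨0, ?_⟩ ⟨k, l, x, hx, rfl, rfl⟩
  rintro _ ⟨k, l, x, -, -, rfl⟩
  exact orderNorm_nonneg P e _

theorem decNorm_le_of_mem_decMajorantCone (he : e ∈ K) (ht : 0 ≤ t)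
    (hv : (t • e, v) ∈ decMajorantCone K) : decNorm (K : Set V) e v ≤ t := by
  obtain ⟨k, l, x, hx, rfl, hsub⟩ := mem_decMajorantCone.1 hv
  exact (decNorm_sum_smul_le_orderNorm e l hx).trans (orderNorm_le_of_mem he
    (K.sum_mem fun j _ => K.smul_mem (norm_nonneg _) (hx j)) ht hsub)

variable [StarAddMonoid V]

namespace IsOrderUnitCone

theorem unit_mem (hK : IsOrderUnitCone K e) : e ∈ K := by
  obtain ⟨r, hr, hre⟩ := hK.exists_smul_sub_mem 0 (.zero V)
  simpa [smul_smul, inv_mul_cancel₀ hr.ne'] using K.smul_mem (inv_nonneg.2 hr.le) hre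

theorem smul_sub_mem_of_orderNorm_lt (hK : IsOrderUnitCone K e) (hh : h ∈ K)
    (ht : orderNorm (K : Set V) e h < t) : t • e - h ∈ K := by
  obtain ⟨q, hq, hqe⟩ := hK.exists_smul_sub_mem h (hK.isSelfAdjoint h hh)
  obtain ⟨r, ⟨-, -, hre⟩, hrt⟩ := exists_lt_of_csInf_lt
    (by exact ⟨q, hq.le, add_mem hh (K.smul_mem hq.le hK.unit_mem), hqe⟩) ht
  have := add_mem (K.smul_mem (sub_nonneg.2 hrt.le) hK.unit_mem) hre
  rwa [Complex.coe_smul, ← add_sub_assoc, ← add_smul, sub_add_cancel] at this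

theorem exists_smul_mem_decMajorantCone_of_isSelfAdjoint (hK : IsOrderUnitCone K e)
    (hh : IsSelfAdjoint h) (c : ℂ) : ∃ h', (h', c • h) ∈ decMajorantCone K := by
  obtain ⟨r, -, hrh⟩ := hK.exists_smul_sub_mem h hh
  have hsub := add_mem (norm_smul_smul_mem_decMajorantCone hK.unit_mem (c * r))
    (norm_smul_smul_mem_decMajorantCone hrh (-c))
  have hdecomp : (c * r) • e + -c • (r • e - h) = c • h := by
    rw [← Complex.coe_smul]
    module
  rw [Prod.mk_add_mk, hdecomp] at hsub
  exact ⟨_, hsub⟩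

variable [StarModule ℂ V]

theorem exists_mem_decMajorantCone (hK : IsOrderUnitCone K e) (v : V) :
    ∃ h, (h, v) ∈ decMajorantCone K := by
  obtain ⟨h, hre⟩ := hK.exists_smul_mem_decMajorantCone_of_isSelfAdjoint (ℜ v).2 1
  obtain ⟨h', him⟩ := hK.exists_smul_mem_decMajorantCone_of_isSelfAdjoint (ℑ v).2 Complex.I
  have hsum := add_mem hre him
  rw [Prod.mk_add_mk, one_smul, realPart_add_I_smul_imaginaryPart] at hsum
  exact ⟨_, hsum⟩

theorem exists_smul_add_mem_decMajorantCone (hK : IsOrderUnitCone K e) (hh : IsSelfAdjoint h)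
    (v : V) : ∃ a : ℝ, 0 ≤ a ∧ (a • e + h, v) ∈ decMajorantCone K := by
  obtain ⟨h', hv⟩ := hK.exists_mem_decMajorantCone v
  obtain ⟨a, ha, hae⟩ := hK.exists_smul_sub_mem (h' - h)
    ((hK.isSelfAdjoint h' (mem_of_mem_decMajorantCone hv)).sub hh)
  refine ⟨a, ha.le, mem_decMajorantCone_of_sub_mem hv ?_⟩
  rwa [add_sub_assoc, ← neg_sub h' h, ← sub_eq_add_neg]

theorem mem_decMajorantCone_of_decNorm_lt (hK : IsOrderUnitCone K e)
    (hv : decNorm (K : Set V) e v < t) : (t • e, v) ∈ decMajorantCone K := by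
  obtain ⟨h, hh⟩ := hK.exists_mem_decMajorantCone v
  obtain ⟨k₀, l₀, x₀, hx₀, hv₀, -⟩ := mem_decMajorantCone.1 hh
  obtain ⟨_, ⟨k, l, x, hx, hdecomp, rfl⟩, hlt⟩ :=
    exists_lt_of_csInf_lt (by exact ⟨_, k₀, l₀, x₀, hx₀, hv₀, rfl⟩) hv
  simp only [Complex.coe_smul] at hlt
  exact mem_decMajorantCone.2 ⟨k, l, x, hx, hdecomp,
    hK.smul_sub_mem_of_orderNorm_lt
      (K.sum_mem fun j _ => K.smul_mem (norm_nonneg _) (hx j)) hlt⟩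

theorem mem_cMax_two_iff (hK : IsOrderUnitCone K e) :
    !![(t : ℂ) • e, v; star v, (t : ℂ) • e] ∈ cMax (K : Set V) e 2 ↔
      ∀ r : ℝ, 0 < r → ((t + r) • e, v) ∈ decMajorantCone K := by
  refine forall₂_congr fun r _ => ?_
  rw [← mem_dMax_two_iff_mem_decMajorantCone hK.isSelfAdjoint]
  refine iff_of_eq (congrArg (· ∈ dMax (K : Set V) 2) ?_)
  ext p q
  fin_cases p <;> fin_cases q <;> simp [add_smul, add_comm]

theorem isLeast_decNorm (hK : IsOrderUnitCone K e) (v : V) :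
    IsLeast {t : ℝ | 0 ≤ t ∧ !![(t : ℂ) • e, v; star v, (t : ℂ) • e] ∈ cMax (K : Set V) e 2}
      (decNorm (K : Set V) e v) := by
  refine ⟨⟨decNorm_nonneg _ _ _, hK.mem_cMax_two_iff.2 fun r hr => ?_⟩, fun t ⟨ht, hmem⟩ => ?_⟩
  · exact hK.mem_decMajorantCone_of_decNorm_lt (lt_add_of_pos_right _ hr)
  · exact le_of_forall_pos_le_add fun r hr => decNorm_le_of_mem_decMajorantCone hK.unit_mem
      (add_nonneg ht hr.le) (hK.mem_cMax_two_iff.1 hmem r hr)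

theorem decNorm_eq_omaxNorm (hK : IsOrderUnitCone K e) (v : V) :
    decNorm (K : Set V) e v = omaxNorm (K : Set V) e v :=
  (hK.isLeast_decNorm v).csInf_eq.symm

end IsOrderUnitCone

end OrderUnit

section UnitalPositive

variable {V : Type u} [AddCommGroup V] [Module ℂ V] {H : Type w} [NormedAddCommGroup H]
  [InnerProductSpace ℂ H] [CompleteSpace H]

theorem IsUnitalPositive.norm_le_of_mem_decMajorantCone {K : PointedCone ℝ V} {e v : V} {t : ℝ}
    {φ : V →ₗ[ℂ] (H →L[ℂ] H)} (hφ : IsUnitalPositive (K : Set V) e φ) (ht : 0 ≤ t)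
    (hv : (t • e, v) ∈ decMajorantCone K) : ‖φ v‖ ≤ t := by
  obtain ⟨k, l, x, hx, rfl, hsub⟩ := mem_decMajorantCone.1 hv
  have hpos : 0 ≤ ∑ j, ‖l j‖ • φ (x j) := Finset.sum_nonneg fun j _ => smul_nonneg (norm_nonneg _)
    ((ContinuousLinearMap.nonneg_iff_isPositive _).2 (hφ.positive _ (hx j)))
  have hle : ∑ j, ‖l j‖ • φ (x j) ≤ algebraMap ℝ (H →L[ℂ] H) t := by
    have := (ContinuousLinearMap.nonneg_iff_isPositive _).2 (hφ.positive _ hsub)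
    rw [map_sub, map_sum, sub_nonneg] at this
    simpa only [LinearMap.map_smul_of_tower, hφ.unital, ← Algebra.algebraMap_eq_smul_one] using this
  calc ‖φ (∑ j, l j • x j)‖ = ‖∑ j, l j • φ (x j)‖ := by simp only [map_sum, map_smul]
    _ ≤ ‖∑ j, ‖l j‖ • φ (x j)‖ :=
      norm_sum_smul_le_norm_sum_norm_smul _ _ fun j _ => hφ.positive _ (hx j)
    _ ≤ t := (CStarAlgebra.norm_le_iff_le_algebraMap _ ht hpos).2 hle

theorem IsUnitalPositive.norm_le_decNorm [StarAddMonoid V] [StarModule ℂ V]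
    {K : PointedCone ℝ V} {e : V} (hK : IsOrderUnitCone K e) {φ : V →ₗ[ℂ] (H →L[ℂ] H)}
    (hφ : IsUnitalPositive (K : Set V) e φ) (v : V) : ‖φ v‖ ≤ decNorm (K : Set V) e v :=
  le_of_forall_gt_imp_ge_of_dense fun _ ht => hφ.norm_le_of_mem_decMajorantCone
    ((decNorm_nonneg _ _ _).trans ht.le) (hK.mem_decMajorantCone_of_decNorm_lt ht)

theorem exists_isUnitalPositive_of_isStrictlyPositive {P : Set V} {e : V}
    {ψ : V →ₗ[ℂ] (H →L[ℂ] H)} (hψ : ∀ x ∈ P, (ψ x).IsPositive) (he : IsStrictlyPositive (ψ e)) :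
    ∃ (φ : V →ₗ[ℂ] (H →L[ℂ] H)) (y : H →L[ℂ] H), IsUnitalPositive P e φ ∧
      ∀ v, ψ v = star y * φ v * y := by
  obtain ⟨_, ⟨y, rfl⟩, hy⟩ := CStarAlgebra.isStrictlyPositive_iff_eq_star_mul_self.1 he
  set z : H →L[ℂ] H := ↑y⁻¹
  have hyz : (y : H →L[ℂ] H) * z = 1 := y.mul_inv
  have hzy : z * (y : H →L[ℂ] H) = 1 := y.inv_mul
  have hzy' : star (y : H →L[ℂ] H) * star z = 1 := by rw [← star_mul, hzy, star_one]
  have hyz' : star z * star (y : H →L[ℂ] H) = 1 := by rw [← star_mul, hyz, star_one]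
  refine ⟨(LinearMap.mulLeft ℂ (star z) ∘ₗ LinearMap.mulRight ℂ z) ∘ₗ ψ, y,
    ⟨?_, fun x hx => ?_⟩, fun v => ?_⟩
  · calc star z * (ψ e * z) = star z * star ↑y * (↑y * z) := by rw [hy]; noncomm_ring
      _ = 1 := by rw [hyz, hyz', one_mul]
  · exact (hψ x hx).adjoint_conj z
  · calc ψ v = star ↑y * star z * ψ v * (z * ↑y) := by rw [hzy, hzy', one_mul, mul_one]
      _ = star ↑y * (star z * (ψ v * z)) * ↑y := by noncomm_ring

theorem norm_inner_star_mul_mul_le (y T : H →L[ℂ] H) {ξ η : H}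
    (hξ : ⟪ξ, (star y * y) ξ⟫_ℂ = 1) (hη : ⟪η, (star y * y) η⟫_ℂ = 1) :
    ‖⟪ξ, (star y * T * y) η⟫_ℂ‖ ≤ ‖T‖ := by
  have hnorm : ∀ ζ : H, ⟪ζ, (star y * y) ζ⟫_ℂ = 1 → ‖y ζ‖ = 1 := fun ζ hζ => by
    rw [ContinuousLinearMap.star_eq_adjoint, mul_apply_eq_comp,
      ContinuousLinearMap.adjoint_inner_right, inner_self_eq_norm_sq_to_K] at hζ
    have : ‖y ζ‖ ^ 2 = 1 := Complex.ofReal_injective (by simpa using hζ)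
    exact (pow_eq_one_iff_of_nonneg (norm_nonneg _) two_ne_zero).1 this
  rw [ContinuousLinearMap.star_eq_adjoint, mul_apply_eq_comp, mul_apply_eq_comp,
    ContinuousLinearMap.adjoint_inner_right]
  calc ‖⟪y ξ, T (y η)⟫_ℂ‖ ≤ ‖y ξ‖ * ‖T (y η)‖ := norm_inner_le_norm _ _
    _ ≤ ‖y ξ‖ * (‖T‖ * ‖y η‖) := by
      gcongr
      exact T.le_opNorm _
    _ = ‖T‖ := by rw [hnorm ξ hξ, hnorm η hη, one_mul, mul_one]

theorem exists_isUnitalPositive_norm_inner_le {P : Set V} {e : V} {ψ : V →ₗ[ℂ] (H →L[ℂ] H)}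
    (hψ : ∀ x ∈ P, (ψ x).IsPositive) (he : IsStrictlyPositive (ψ e)) {ξ η : H}
    (hξ : ⟪ξ, ψ e ξ⟫_ℂ = 1) (hη : ⟪η, ψ e η⟫_ℂ = 1) :
    ∃ φ : V →ₗ[ℂ] (H →L[ℂ] H), IsUnitalPositive P e φ ∧ ∀ v, ‖⟪ξ, ψ v η⟫_ℂ‖ ≤ ‖φ v‖ := by
  obtain ⟨φ, y, hφ, hψφ⟩ := exists_isUnitalPositive_of_isStrictlyPositive hψ he
  rw [hψφ, hφ.unital, mul_one] at hξ hη
  exact ⟨φ, hφ, fun v => hψφ v ▸ norm_inner_star_mul_mul_le y (φ v) hξ hη⟩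

end UnitalPositive

section OffDiagonal

variable {V : Type u} [AddCommGroup V] [Module ℂ V] [StarAddMonoid V] [StarModule ℂ V]
  {H : Type w} [NormedAddCommGroup H] [InnerProductSpace ℂ H] {s f : V →ₗ[ℂ] ℂ} {ξ η : H} {x : V}

/-- The linear map into `B(H)` which, for orthonormal `ξ` and `η`, has diagonal entries `s` and
off-diagonal entries `f` and `f^*` with respect to `ξ` and `η`, where `f^* x` is the conjugate of
`f (x^*)`; on the orthogonal complement of `ξ` and `η` it is the scalar `s`. -/
noncomputable def offDiagMap (s f : V →ₗ[ℂ] ℂ) (ξ η : H) : V →ₗ[ℂ] (H →L[ℂ] H) where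
  toFun x := s x • 1 + (f x • rankOne ℂ ξ η + star (f (star x)) • rankOne ℂ η ξ)
  map_add' x y := by
    simp only [map_add, star_add]
    module
  map_smul' c x := by
    simp only [map_smul, star_smul, smul_eq_mul, star_mul', star_star, RingHom.id_apply]
    module

theorem offDiagMap_apply (x : V) : offDiagMap s f ξ η x =
    s x • 1 + (f x • rankOne ℂ ξ η + star (f (star x)) • rankOne ℂ η ξ) :=
  rfl

theorem inner_offDiagMap (hξη : Orthonormal ℂ ![ξ, η]) (x : V) :
    ⟪ξ, offDiagMap s f ξ η x ξ⟫_ℂ = s x ∧ ⟪η, offDiagMap s f ξ η x η⟫_ℂ = s x ∧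
      ⟪ξ, offDiagMap s f ξ η x η⟫_ℂ = f x := by
  have hξ : ‖ξ‖ = 1 := hξη.1 0
  have hη : ‖η‖ = 1 := hξη.1 1
  have hinner : ⟪ξ, η⟫_ℂ = 0 := hξη.2 zero_ne_one
  have hinner' : ⟪η, ξ⟫_ℂ = 0 := hξη.2 one_ne_zero
  simp [offDiagMap_apply, hinner, hinner', hξ, hη, inner_self_eq_norm_sq_to_K]

theorem isPositive_offDiagMap (hξη : Orthonormal ℂ ![ξ, η]) (hx : IsSelfAdjoint x)
    (hfs : (‖f x‖ : ℂ) ≤ s x) : (offDiagMap s f ξ η x).IsPositive := by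
  rw [offDiagMap_apply, hx.star_eq]
  exact isPositive_smul_one_add_rankOne hξη hfs

variable [CompleteSpace H]

theorem isStrictlyPositive_offDiagMap (hξη : Orthonormal ℂ ![ξ, η]) (hx : IsSelfAdjoint x)
    (hsx : s x = 1) (hfx : ‖f x‖ < 1) : IsStrictlyPositive (offDiagMap s f ξ η x) := by
  have hsplit : offDiagMap s f ξ η x = ((‖f x‖ : ℂ) • (1 : H →L[ℂ] H) +
      (f x • rankOne ℂ ξ η + star (f x) • rankOne ℂ η ξ)) + (1 - ‖f x‖) • 1 := by
    rw [offDiagMap_apply, hx.star_eq, hsx, Complex.coe_smul]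
    module
  rw [hsplit]
  exact (IsStrictlyPositive.smul (sub_pos.2 hfx) isStrictlyPositive_one).nonneg_add
    ((ContinuousLinearMap.nonneg_iff_isPositive _).2 (isPositive_smul_one_add_rankOne hξη le_rfl))

theorem exists_isUnitalPositive_norm_apply_le {P : Set V} {e : V} (hξη : Orthonormal ℂ ![ξ, η])
    (hP : ∀ x ∈ P, IsSelfAdjoint x) (he : IsSelfAdjoint e)
    (hfs : ∀ x ∈ P, (‖f x‖ : ℂ) ≤ s x) (hse : s e = 1) (hfe : ‖f e‖ < 1) :
    ∃ φ : V →ₗ[ℂ] (H →L[ℂ] H), IsUnitalPositive P e φ ∧ ∀ v, ‖f v‖ ≤ ‖φ v‖ := by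
  obtain ⟨hξ, hη, -⟩ := inner_offDiagMap (s := s) (f := f) hξη e
  obtain ⟨φ, hφ, hle⟩ := exists_isUnitalPositive_norm_inner_le
    (fun x hx => isPositive_offDiagMap hξη (hP x hx) (hfs x hx))
    (isStrictlyPositive_offDiagMap hξη he hse hfe) (hξ.trans hse) (hη.trans hse)
  exact ⟨φ, hφ, fun v => (inner_offDiagMap hξη v).2.2 ▸ hle v⟩

end OffDiagonal

section Domination

theorem norm_le_of_forall_add_re_mul_nonneg {a : ℝ} {z : ℂ}
    (h : ∀ c : ℂ, ‖c‖ = 1 → 0 ≤ a + (c * z).re) : ‖z‖ ≤ a := by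
  obtain ⟨c, hc, hcz⟩ := Complex.exists_norm_eq_mul_self z
  have := h (-c) (by rwa [norm_neg])
  rw [neg_mul, ← hcz, Complex.neg_re, Complex.ofReal_re] at this
  linarith

variable {V : Type u} [AddCommGroup V] [Module ℂ V] [StarAddMonoid V] [StarModule ℂ V]
  {K : PointedCone ℝ V} {e v : V} {t : ℝ}

theorem IsOrderUnitCone.exists_separating_functionals (hK : IsOrderUnitCone K e)
    (hv : (t • e, v) ∉ decMajorantCone K) :
    ∃ (σ : selfAdjoint V →ₗ[ℝ] ℝ) (g : V →ₗ[ℝ] ℝ),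
      (∀ (h : selfAdjoint V) (w : V), ((h : V), w) ∈ decMajorantCone K → 0 ≤ σ h + g w) ∧
      σ ⟨e, hK.isSelfAdjoint e hK.unit_mem⟩ = 1 ∧ t + g v ≤ 0 := by
  set e' : selfAdjoint V := ⟨e, hK.isSelfAdjoint e hK.unit_mem⟩
  let C : PointedCone ℝ (selfAdjoint V × V) :=
    (decMajorantCone K).comap ((selfAdjoint.submodule ℝ V).subtype.prodMap LinearMap.id)
  obtain ⟨g, hgC, hge, hgv⟩ := exists_normalized_nonneg_functional_of_notMem (C := C)
    (u := (e', 0)) (y := (t • e', v)) (fun ⟨h, w⟩ => by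
      simpa [C, e'] using! hK.exists_smul_add_mem_decMajorantCone h.2 w) hv
  have hg : ∀ h w, g (h, w) = g (h, 0) + g (0, w) := fun h w => by simp [← map_add]
  refine ⟨g ∘ₗ LinearMap.inl ℝ _ _, g ∘ₗ LinearMap.inr ℝ _ _, fun h w hhw => ?_, hge, ?_⟩
  · exact hg h w ▸ hgC (h, w) hhw
  · have : g (t • e', 0) = t := by
      rw [← smul_zero t, ← Prod.smul_mk, map_smul, hge, smul_eq_mul, mul_one]
    rwa [hg, this] at hgv

theorem IsOrderUnitCone.exists_dominated_functional (hK : IsOrderUnitCone K e)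
    (hv : (t • e, v) ∉ decMajorantCone K) :
    ∃ s f : V →ₗ[ℂ] ℂ, (∀ x ∈ K, (‖f x‖ : ℂ) ≤ s x) ∧ s e = 1 ∧ t ≤ ‖f v‖ := by
  obtain ⟨σ, g, hσg, hσe, hgv⟩ := hK.exists_separating_functionals hv
  let s : V →ₗ[ℂ] ℂ := Module.Dual.extendRCLike (σ ∘ₗ realPart)
  let f : V →ₗ[ℂ] ℂ := Module.Dual.extendRCLike g
  have hf : ∀ w, (f w).re = g w := fun w => by
    simp [f, Module.Dual.extendRCLike_apply]
  have hs : ∀ x (hx : IsSelfAdjoint x), s x = σ ⟨x, hx⟩ := fun x hx => by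
    have hre : ℜ x = ⟨x, hx⟩ := Subtype.ext hx.coe_realPart
    simp [s, Module.Dual.extendRCLike_apply, realPart_I_smul, hx.imaginaryPart, hre]
  refine ⟨s, f, fun x hx => ?_, ?_, ?_⟩
  · rw [hs x (hK.isSelfAdjoint x hx), Complex.real_le_real]
    refine norm_le_of_forall_add_re_mul_nonneg fun c hc => ?_
    have := hσg ⟨x, hK.isSelfAdjoint x hx⟩ (c • x)
      (by simpa [hc] using norm_smul_smul_mem_decMajorantCone hx c)
    rwa [← hf, map_smul, smul_eq_mul] at this
  · rw [hs e (hK.isSelfAdjoint e hK.unit_mem), hσe, Complex.ofReal_one]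
  · have := (abs_le.1 (Complex.abs_re_le_norm (f v))).1
    rw [hf] at this
    linarith

end Domination

section Supremum

variable {V : Type u} [AddCommGroup V] [Module ℂ V] [StarAddMonoid V] [StarModule ℂ V]

namespace IsOrderUnitCone

variable {K : PointedCone ℝ V} {e v : V} {b : ℝ}

theorem exists_isUnitalPositive_lt_norm {H : Type w} [NormedAddCommGroup H]
    [InnerProductSpace ℂ H] [CompleteSpace H] {ξ η : H} (hξη : Orthonormal ℂ ![ξ, η])
    (hK : IsOrderUnitCone K e) (hb : 0 ≤ b) (hbv : b < decNorm (K : Set V) e v) :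
    ∃ φ : V →ₗ[ℂ] (H →L[ℂ] H), IsUnitalPositive (K : Set V) e φ ∧ b < ‖φ v‖ := by
  obtain ⟨t, hbt, htv⟩ := exists_between hbv
  have ht : 0 < t := hb.trans_lt hbt
  obtain ⟨s, f, hfs, hse, hft⟩ := hK.exists_dominated_functional fun hmem =>
    htv.not_ge (decNorm_le_of_mem_decMajorantCone hK.unit_mem ht.le hmem)
  obtain ⟨c, hbc, hc⟩ := exists_between ((div_lt_one ht).2 hbt)
  have hc0 : 0 < c := (div_nonneg hb ht.le).trans_lt hbc
  -- Shrinking `f` makes the value of the positive map at `e` invertible.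
  have hnorm : ∀ x, ‖((c : ℂ) • f) x‖ = c * ‖f x‖ := fun x => by
    simp [abs_of_pos hc0]
  have hfe : ‖f e‖ ≤ 1 := by exact_mod_cast (hfs e hK.unit_mem).trans_eq hse
  obtain ⟨φ, hφ, hle⟩ := exists_isUnitalPositive_norm_apply_le (f := (c : ℂ) • f) hξη
    hK.isSelfAdjoint (hK.isSelfAdjoint e hK.unit_mem)
    (fun x hx => le_trans (by
      rw [hnorm]
      exact_mod_cast mul_le_of_le_one_left (norm_nonneg _) hc.le) (hfs x hx)) hse
    (by rw [hnorm]; nlinarith)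
  refine ⟨φ, hφ, ?_⟩
  calc b < c * t := (div_lt_iff₀ ht).1 hbc
    _ ≤ c * ‖f v‖ := by gcongr
    _ ≤ ‖φ v‖ := hnorm v ▸ hle v

theorem isLUB_norm_isUnitalPositive (hK : IsOrderUnitCone K e) (v : V) :
    IsLUB {t : ℝ | ∃ (H : Type w) (_ : NormedAddCommGroup H) (_ : InnerProductSpace ℂ H)
        (_ : CompleteSpace H) (φ : V →ₗ[ℂ] (H →L[ℂ] H)),
        IsUnitalPositive (K : Set V) e φ ∧ t = ‖φ v‖}
      (decNorm (K : Set V) e v) := by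
  refine ⟨?_, fun b hb => ?_⟩
  · rintro _ ⟨H, _, _, _, φ, hφ, rfl⟩
    exact hφ.norm_le_decNorm hK v
  have hb0 : 0 ≤ b := by
    refine hb ⟨EuclideanSpace ℂ PEmpty.{w + 1}, inferInstance, inferInstance, inferInstance, 0,
      ⟨Subsingleton.elim _ _, fun x _ => ?_⟩, by simp⟩
    exact ContinuousLinearMap.isPositive_zero
  by_contra! hlt
  have hortho : Orthonormal ℂ ![EuclideanSpace.single (ULift.up.{w} (0 : Fin 2)) (1 : ℂ),
      EuclideanSpace.single (ULift.up 1) 1] := by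
    convert EuclideanSpace.orthonormal_single.comp _ (ULift.up_injective (α := Fin 2)) using 1
    funext i
    fin_cases i <;> rfl
  obtain ⟨φ, hφ, hbφ⟩ := hK.exists_isUnitalPositive_lt_norm hortho hb0 hlt
  exact hbφ.not_ge (hb ⟨_, _, _, inferInstance, φ, hφ, rfl⟩)

end IsOrderUnitCone

end Supremum

section AOUSpace

variable {V : Type u} [AddCommGroup V] [Module ℂ V] [StarAddMonoid V] {P : Set V} {e : V}

/-- The positive cone of an AOU space, as a convex cone over the nonnegative reals. -/
def IsAOUSpace.cone (hV : IsAOUSpace P e) : PointedCone ℝ V where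
  carrier := P
  zero_mem' := by
    obtain ⟨x, hx⟩ := hV.nonempty
    simpa using hV.smul_mem 0 le_rfl x hx
  add_mem' hx hy := hV.add_mem _ hx _ hy
  smul_mem' r x hx := hV.smul_mem r r.2 x hx

theorem IsAOUSpace.isOrderUnitCone (hV : IsAOUSpace P e) : IsOrderUnitCone hV.cone e where
  isSelfAdjoint := hV.hermitian
  exists_smul_sub_mem := hV.order_unit

end AOUSpace

end OMax

theorem mainTheorem7_general {V : Type u} [AddCommGroup V] [Module ℂ V] [StarAddMonoid V]
    [StarModule ℂ V] (K : PointedCone ℝ V) (e : V) (hK : OMax.IsOrderUnitCone K e) (v : V) :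
    OMax.decNorm (K : Set V) e v = OMax.omaxNorm (K : Set V) e v ∧
    IsLUB {t : ℝ | ∃ (H : Type w) (_ : NormedAddCommGroup H) (_ : InnerProductSpace ℂ H)
        (_ : CompleteSpace H) (φ : V →ₗ[ℂ] (H →L[ℂ] H)),
        OMax.IsUnitalPositive (K : Set V) e φ ∧ t = ‖φ v‖}
      (OMax.omaxNorm (K : Set V) e v) :=
  ⟨hK.decNorm_eq_omaxNorm v, hK.decNorm_eq_omaxNorm v ▸ hK.isLUB_norm_isUnitalPositive v⟩

theorem mainTheorem7 {V : Type u} [AddCommGroup V] [Module ℂ V] [StarAddMonoid V]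
    [StarModule ℂ V] (P : Set V) (e : V) (hV : OMax.IsAOUSpace P e) (v : V) :
    OMax.decNorm P e v = OMax.omaxNorm P e v ∧
    IsLUB {t : ℝ | ∃ (H : Type w) (_ : NormedAddCommGroup H) (_ : InnerProductSpace ℂ H)
        (_ : CompleteSpace H) (φ : V →ₗ[ℂ] (H →L[ℂ] H)),
        OMax.IsUnitalPositive P e φ ∧ t = ‖φ v‖}
      (OMax.omaxNorm P e v) :=
  mainTheorem7_general hV.cone e hV.isOrderUnitCone v
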